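/- Let $G$ be a finite group, let $V\neq 0$ be a finite-dimensional complex Hilbert space and let $\pi:G\to U(V)$ be a unitary representation. Let $X$ be a transitive $G$-set and let $f:G\to X$ be a map of left $G$-sets, i.e. $f(gh)=g\cdot f(h)$ for all $g,h\in G$. Let $H\le G$ be the stabilizer of some point $x_0\in X$. A single-query algorithm $\mathcal A$ for $(G,V,f)$ consists of an integer $N\ge 0$, a unit vector $|\psi\rangle\in V\otimes\mathbb C^N$, a unitary operator $U$ on $V\otimes\mathbb C^N$ and a POVM $\{E_x\}_{x\in X}$ on $V\otimes\mathbb C^N$ (positive operators with $\sum_{x\in X}E_x=I$). When the oracle hides $a\in G$ it produces the state $|\psi_a\rangle=U(\pi(a)\otimes I)|\psi\rangle$, and its success probability, for $a$ uniform in $G$, is $$P_{\rm succ}(\mathcal A)=\frac1{|G|}\sum_{a\in G}\langle\psi_a|E_{f(a)}|\psi_a\rangle .$$ For a finite-dimensional complex representation $Y$ of $H$ let $Y^{\uparrow}=\mathbb C G\otimes_{\mathbb C H}Y$ be the induced representation of $G$, and let $(Y^{\uparrow})_V$ be the sum of all isotypic components of $Y^{\uparrow}$ whose irreducible type occurs in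 $V$. Let $\mathrm{Irr}(H)$ denote the set of irreducible complex representations of $H$ up to isomorphism. Then the maximum of $P_{\rm succ}(\mathcal A)$ over all single-query algorithms $\mathcal A$ is attained, and $$P_{\rm opt}=\max_{\mathcal A}P_{\rm succ}(\mathcal A)=\max_{Y\in\mathrm{Irr}(H)}\frac{\dim\,(Y^{\uparrow})_V}{\dim Y^{\uparrow}} .$$ -/

import Mathlib

open scoped TensorProduct

namespace CosetIdentification

noncomputable section

/-! ### Single-query algorithms -/

/-- The joint space `V ⊗ ℂᴺ` of the query register and an `N`-dimensional workspace. -/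
abbrev Register (V : Type*) [NormedAddCommGroup V] [InnerProductSpace ℂ V] (N : ℕ) : Type _ :=
  V ⊗[ℂ] EuclideanSpace ℂ (Fin N)

/-- A quantum algorithm which makes one query to an oracle acting on `V` and then produces an
outcome in `X`: a workspace dimension, an input state, the unitary applied after the query, and a
POVM with outcomes in `X`. -/
structure SingleQueryAlgorithm (V : Type*) [NormedAddCommGroup V] [InnerProductSpace ℂ V]
    (X : Type*) [Fintype X] where
  /-- dimension of the workspace -/
  N : ℕ
  /-- input state -/
  state : Register V N
  norm_state : ‖state‖ = 1
  /-- unitary operator applied after the query -/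
  U : Register V N ≃ₗᵢ[ℂ] Register V N
  /-- measurement operators -/
  E : X → (Register V N →ₗ[ℂ] Register V N)
  isPositive_E : ∀ x, (E x).IsPositive
  sum_E : ∑ x, E x = LinearMap.id

namespace SingleQueryAlgorithm

variable {G V X : Type*} [Group G] [NormedAddCommGroup V] [InnerProductSpace ℂ V] [Fintype X]

/-- The state `U (π(a) ⊗ I) |ψ⟩` produced when the oracle hides `a`. -/
def output (𝒜 : SingleQueryAlgorithm V X) (π : Representation ℂ G V) (a : G) :
    Register V 𝒜.N :=
  𝒜.U (TensorProduct.map (π a) LinearMap.id 𝒜.state)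

/-- The probability `⟨ψ_a | E_x | ψ_a⟩` of the outcome `x` when the oracle hides `a`. -/
def outcomeProb (𝒜 : SingleQueryAlgorithm V X) (π : Representation ℂ G V) (x : X) (a : G) : ℝ :=
  (inner ℂ (𝒜.output π a) (𝒜.E x (𝒜.output π a))).re

/-- The probability that the outcome is `f a`, for `a` uniformly distributed in `G`. -/
def successProb [Fintype G] (𝒜 : SingleQueryAlgorithm V X) (π : Representation ℂ G V)
    (f : G → X) : ℝ :=
  (1 / (Fintype.card G : ℝ)) * ∑ a : G, 𝒜.outcomeProb π (f a) a

end SingleQueryAlgorithm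

/-! ### The part of a representation which is shared with another one -/

section Shared

variable {G A B : Type*} [Group G] [AddCommGroup A] [Module ℂ A] [AddCommGroup B] [Module ℂ B]

/-- The sum of all isotypic components of `α` whose irreducible type occurs in `β`, that is, the
sum of all irreducible subrepresentations of `α` isomorphic to a subrepresentation of `β`. -/
def sharedPart (α : Representation ℂ G A) (β : Representation ℂ G B) : Submodule ℂ A :=
  sSup {S | ∃ σ : Subrepresentation α, σ.toRepresentation.IsIrreducible ∧
    (∃ τ : Subrepresentation β, Nonempty (σ.toRepresentation.Equiv τ.toRepresentation)) ∧
    S = σ.toSubmodule}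

/-- For a representation `ρ` of `H ≤ G` on `Y`, the number `dim (Y↑)_V / dim Y↑`, where
`Y↑ = ℂ[G] ⊗_{ℂ[H]} Y` is the induced representation (Mathlib realizes it as the quotient of
`ℂ[G] ⊗ Y` by the relations `h g ⊗ ρ h y = g ⊗ y`, the class of `g ⊗ y` standing for the tensor
`g⁻¹ ⊗ y` over `ℂ[H]`). -/
def sharedFraction {H : Subgroup G} {Y V : Type*} [AddCommGroup Y] [Module ℂ Y]
    [AddCommGroup V] [Module ℂ V] (ρ : Representation ℂ H Y) (π : Representation ℂ G V) : ℝ :=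
  (Module.finrank ℂ (sharedPart (Representation.ind H.subtype ρ) π) : ℝ) /
    (Module.finrank ℂ (Representation.IndV H.subtype ρ) : ℝ)

end Shared

end

end CosetIdentification

/-!
Let `τ = π ⊗ I` be the action on the joint space `W = V ⊗ ℂᴺ`, and let `H` be the stabilizer of
`x₀`. Both bounds compare algorithms with `H`-invariant subspaces `B` of `W`, through the number
`dim (G B) / ([G : H] dim B)`, where `G B` is the span of the translates `g B`.

*Upper bound* (`averageSuccess_upper`). After absorbing the unitary into the POVM, the success
probability is the expectation of the `H`-invariant operator `Ē = |G|⁻¹ ∑ a, τ(a)⁻¹ E_{a x₀} τ(a)`,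
so it is at most the largest eigenvalue `l` of `Ē`. Let `Y` be an irreducible `H`-subrepresentation of
the eigenspace of `l`. As `G Y` is invariant under `G`, the trace of `Ē` over `G Y` is
`dim (G Y) / |X|`, and it is at least `l dim Y`. Now `G Y` is the image of an equivariant map from
the induced representation `Y↑` to `V ⊗ ℂᴺ`, so that `dim (G Y) ≤ dim (Y↑)_V`
(`finrank_range_le_finrank_sharedPart`), while `dim Y↑ = |X| dim Y` (`finrank_indV`).

*Lower bound* (`averageSuccess_lower`). Given a representation `Y` of `H`, a basis of `Hom_G(Y↑, V)`
gives an equivariant map from `Y↑` to some `V ⊗ ℂᴺ` which is injective on `(Y↑)_V`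
(`exists_equivariant_injOn_sharedPart`). Let `B` be the image of `Y`, so that `G B` is the image of
`Y↑`. The square-root measurement built from the projections onto the subspaces `g B` is covariant
and resolves the projection onto `G B`. Hence its element for `x₀` has trace `dim (G B) / |X|`, and
its largest eigenvalue is at least `dim (G B) / (|X| dim B)`, because its rank is at most `dim B`.
An added multiple of the projection onto the orthogonal complement of `G B` completes the POVM.

The irreducible representations of `H` have dimension at most `|H|`, so the fractions form a finite
set (`finite_sharedFraction`). It therefore has a maximum, and the two bounds identify this maximum
with that of the success probabilities.
-/

namespace CosetIdentification

/-! ### Operators on finite-dimensional Hilbert spaces -/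

section Operators

variable {W : Type*} [NormedAddCommGroup W] [InnerProductSpace ℂ W] [FiniteDimensional ℂ W]

/-- An invertible positive operator has a positive inverse square root, which commutes with
everything the operator commutes with. -/
theorem exists_isPositive_invSqrt (S : W →ₗ[ℂ] W) (hS : S.IsPositive)
    (hinj : Function.Injective S) :
    ∃ R : W →ₗ[ℂ] W, R.IsPositive ∧ R * S * R = 1 ∧
      ∀ T : W →ₗ[ℂ] W, Commute S T → Commute R T := by
  have : CompleteSpace W := FiniteDimensional.complete ℂ W
  let φ := Module.End.toContinuousLinearMap (𝕜 := ℂ) W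
  have hSu : IsUnit S := by
    rw [Module.End.isUnit_iff]
    exact ⟨hinj, LinearMap.injective_iff_surjective.mp hinj⟩
  have hφ0 : (0 : W →L[ℂ] W) ≤ φ S := by
    rw [ContinuousLinearMap.nonneg_iff_isPositive]
    exact (LinearMap.isPositive_toContinuousLinearMap_iff S).mpr hS
  have hφu : IsUnit (φ S) := hSu.map φ
  have hpos : IsStrictlyPositive (φ S) := ⟨hφ0, hφu⟩
  refine ⟨φ.symm ((φ S) ^ (-(1 / 2) : ℝ)), ?_, ?_, ?_⟩
  · have h : (0 : W →L[ℂ] W) ≤ (φ S) ^ (-(1 / 2) : ℝ) := CFC.rpow_nonneg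
    rw [ContinuousLinearMap.nonneg_iff_isPositive] at h
    exact (ContinuousLinearMap.isPositive_toLinearMap_iff _).mpr h
  · apply φ.injective
    rw [map_mul, map_mul, map_one, φ.apply_symm_apply]
    nth_rewrite 2 [← CFC.rpow_one (φ S)]
    rw [← CFC.rpow_add hφu, ← CFC.rpow_add hφu]
    norm_num
    exact CFC.rpow_zero _
  · intro T hT
    have h := (hT.map φ).cfc_nnreal (fun x => x ^ (-(1 / 2) : ℝ))
    have h2 := h.map φ.symm
    rw [φ.symm_apply_apply] at h2
    exact h2

/-- The orthogonal projection onto `M`, as a linear (rather than continuous linear) map. -/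
noncomputable abbrev orthProj (M : Submodule ℂ W) : W →ₗ[ℂ] W := (M.starProjection : W →ₗ[ℂ] W)

theorem orthProj_isPositive (M : Submodule ℂ W) : (orthProj M).IsPositive :=
  M.isSymmetricProjection_starProjection.isPositive

theorem orthProj_mul_self (M : Submodule ℂ W) : orthProj M * orthProj M = orthProj M := by
  ext v
  exact M.starProjection_eq_self_iff.mpr (M.starProjection_apply_mem v)

theorem isPositive_conj_of_isSymmetric {R E : W →ₗ[ℂ] W} (hR : R.IsSymmetric)
    (hE : E.IsPositive) : (R * E * R).IsPositive := by
  have h := hE.conj_adjoint R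
  have hA : LinearMap.adjoint R = R := (LinearMap.isSymmetric_iff_isSelfAdjoint R).mp hR
  rw [hA] at h
  exact h

theorem trace_orthProj (M : Submodule ℂ W) :
    LinearMap.trace ℂ W (orthProj M) = Module.finrank ℂ M := by
  have h : LinearMap.IsProj M (orthProj M) :=
    ⟨fun x => M.starProjection_apply_mem x,
     fun x hx => M.starProjection_eq_self_iff.mpr hx⟩
  exact h.trace

theorem orthProj_mul_of_le {Y M : Submodule ℂ W} (h : Y ≤ M) :
    orthProj M * orthProj Y = orthProj Y := by
  ext v
  exact M.starProjection_eq_self_iff.mpr (h (Y.starProjection_apply_mem v))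

theorem orthProj_mul_of_le' {Y M : Submodule ℂ W} (h : Y ≤ M) :
    orthProj Y * orthProj M = orthProj Y := by
  ext v
  exact congrArg (fun f : W →L[ℂ] W => f v) (Submodule.starProjection_comp_starProjection_of_le h)

theorem orthProj_map (T T' : W →ₗ[ℂ] W) (hT : ∀ v w, inner ℂ (T v) (T w) = inner ℂ v w)
    (hTT' : T * T' = 1) (M : Submodule ℂ W) :
    T * orthProj M * T' = orthProj (M.map T) := by
  ext v
  symm
  apply Submodule.eq_starProjection_of_mem_of_inner_eq_zero
  · exact ⟨_, M.starProjection_apply_mem (T' v), rfl⟩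
  · rintro _ ⟨w, hw, rfl⟩
    have hv : v = T (T' v) := by
      rw [← Module.End.mul_apply, hTT']; rfl
    conv_lhs => rw [hv]
    simp only [Module.End.mul_apply]
    rw [← map_sub, hT, ← Module.End.mul_apply T T', hTT']
    exact M.starProjection_inner_eq_zero _ _ hw

/-- If the positive operator `E` is the scalar `c` on a subspace `Y ≤ M`, then the part of its trace
carried by `M` is at least `c * dim Y`: the part carried by the orthogonal complement of `Y` in `M`
is nonnegative. -/
theorem finrank_mul_le_re_trace (E : W →ₗ[ℂ] W) (hE : E.IsPositive) {Y M : Submodule ℂ W}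
    (hYM : Y ≤ M) {c : ℝ} (hc : ∀ y ∈ Y, E y = (c : ℂ) • y) :
    c * Module.finrank ℂ Y ≤ (LinearMap.trace ℂ W (E * orthProj M)).re := by
  set Q := orthProj M - orthProj Y with hQ
  have hQQ : Q * Q = Q := by
    rw [hQ, mul_sub, sub_mul, sub_mul, orthProj_mul_self, orthProj_mul_self,
      orthProj_mul_of_le hYM, orthProj_mul_of_le' hYM]
    abel
  have hQs : Q.IsSymmetric :=
    (orthProj_isPositive M).isSymmetric.sub (orthProj_isPositive Y).isSymmetric
  have hEY : E * orthProj Y = (c : ℂ) • orthProj Y := by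
    ext v
    exact hc _ (Y.starProjection_apply_mem v)
  have h1 : LinearMap.trace ℂ W (E * orthProj M)
      = c * Module.finrank ℂ Y + LinearMap.trace ℂ W (Q * E * Q) := by
    have : orthProj M = orthProj Y + Q := by rw [hQ]; abel
    rw [this, mul_add, map_add, hEY, map_smul, trace_orthProj, smul_eq_mul,
      LinearMap.trace_mul_cycle, hQQ, LinearMap.trace_mul_comm]
  have h2 : (Q * E * Q).IsPositive := isPositive_conj_of_isSymmetric hQs hE
  have h3 := (Complex.le_def.mp h2.trace_nonneg).1
  rw [h1, Complex.add_re]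
  simp at h3 ⊢
  linarith

/-- Some eigenvalue of a symmetric operator (the largest one) is at least its expectation in a given
unit vector. -/
theorem exists_hasEigenvalue_ge (E : W →ₗ[ℂ] W) (hE : E.IsSymmetric) (ψ : W) (hψ : ‖ψ‖ = 1) :
    ∃ c : ℝ, (inner ℂ ψ (E ψ)).re ≤ c ∧ Module.End.HasEigenvalue E (c : ℂ) := by
  have hψ0 : ψ ≠ 0 := by rintro rfl; simp at hψ
  have : Nontrivial W := ⟨ψ, 0, hψ0⟩
  refine ⟨_, ?_, hE.hasEigenvalue_iSup_of_finiteDimensional⟩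
  let E' := LinearMap.toContinuousLinearMap E
  have hb : BddAbove (Set.range fun x : {x : W // x ≠ 0} =>
      RCLike.re (inner ℂ (E x) (x : W)) / ‖(x : W)‖ ^ 2) := by
    refine ⟨‖E'‖, ?_⟩
    rintro _ ⟨⟨x, hx⟩, rfl⟩
    have hx' : 0 < ‖x‖ := norm_pos_iff.mpr hx
    rw [div_le_iff₀ (by positivity)]
    calc RCLike.re (inner ℂ (E x) x) ≤ ‖E x‖ * ‖x‖ := re_inner_le_norm _ _
      _ ≤ (‖E'‖ * ‖x‖) * ‖x‖ := by gcongr; exact E'.le_opNorm x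
      _ = _ := by ring
  refine le_trans (le_of_eq ?_) (le_ciSup hb ⟨ψ, hψ0⟩)
  simp only [hψ, one_pow, div_one]
  rw [hE ψ ψ]; rfl

end Operators

/-! ### Sums over transitive group actions -/

section Counting

/-- The average of `φ (a • x₀)` over the group is the average of `φ` over the transitive `G`-set. -/
theorem card_smul_sum_orbit {G X A : Type*} [Group G] [Fintype G] [Fintype X] [MulAction G X]
    [MulAction.IsPretransitive G X] [AddCommMonoid A] (x₀ : X) (φ : X → A) :
    Fintype.card X • ∑ a : G, φ (a • x₀) = Fintype.card G • ∑ x, φ x := by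
  have h (x : X) : ∑ a : G, φ (a • x) = ∑ a : G, φ (a • x₀) := by
    obtain ⟨k, rfl⟩ := MulAction.exists_smul_eq G x₀ x
    exact Fintype.sum_equiv (Equiv.mulRight k) _ _ fun a => by simp [mul_smul]
  have h' (a : G) : ∑ x : X, φ (a • x) = ∑ x, φ x :=
    Fintype.sum_equiv (MulAction.toPerm a) _ _ fun x => rfl
  calc Fintype.card X • ∑ a : G, φ (a • x₀) = ∑ x : X, ∑ a : G, φ (a • x) := by
        simp [h]
    _ = ∑ a : G, ∑ x : X, φ (a • x) := Finset.sum_comm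
    _ = _ := by simp [h']

end Counting

/-! ### Unitary representations -/

section Unitary

variable {G W : Type*} [Group G] [NormedAddCommGroup W] [InnerProductSpace ℂ W]

/-- Every group element acts by an isometry. -/
def IsUnitaryRep (τ : Representation ℂ G W) : Prop :=
  ∀ (g : G) (v w : W), inner ℂ (τ g v) (τ g w) = inner ℂ v w

theorem rep_mul_inv (τ : Representation ℂ G W) (g : G) : τ g * τ g⁻¹ = 1 := by
  rw [← map_mul, mul_inv_cancel, map_one]

theorem rep_inv_mul (τ : Representation ℂ G W) (g : G) : τ g⁻¹ * τ g = 1 := by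
  rw [← map_mul, inv_mul_cancel, map_one]

theorem IsUnitaryRep.inner_apply_left {τ : Representation ℂ G W} (hτ : IsUnitaryRep τ) (g : G)
    (v w : W) : inner ℂ (τ g v) w = inner ℂ v (τ g⁻¹ w) := by
  rw [← hτ g v, ← Module.End.mul_apply, rep_mul_inv, Module.End.one_apply]

theorem IsUnitaryRep.norm_apply {τ : Representation ℂ G W} (hτ : IsUnitaryRep τ) (g : G)
    (v : W) : ‖τ g v‖ = ‖v‖ := by
  rw [@norm_eq_sqrt_re_inner ℂ, @norm_eq_sqrt_re_inner ℂ, hτ]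

/-- The smallest subrepresentation containing `B`. -/
def repSpan (τ : Representation ℂ G W) (B : Submodule ℂ W) : Submodule ℂ W :=
  ⨆ g : G, B.map (τ g)

theorem map_repSpan (τ : Representation ℂ G W) (B : Submodule ℂ W) (g : G) :
    (repSpan τ B).map (τ g) = repSpan τ B := by
  rw [repSpan, Submodule.map_iSup]
  refine (Equiv.mulLeft g).iSup_congr fun h => ?_
  rw [← Submodule.map_comp, Equiv.coe_mulLeft, map_mul]
  rfl

theorem le_repSpan (τ : Representation ℂ G W) (B : Submodule ℂ W) : B ≤ repSpan τ B := by
  refine le_trans (le_of_eq ?_) (le_iSup _ (1 : G))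
  rw [map_one]; exact B.map_id.symm

variable [FiniteDimensional ℂ W]

theorem IsUnitaryRep.isPositive_conj {τ : Representation ℂ G W} (hτ : IsUnitaryRep τ) (g : G)
    {E : W →ₗ[ℂ] W} (hE : E.IsPositive) : (τ g⁻¹ * E * τ g).IsPositive := by
  have h := hE.adjoint_conj (τ g)
  have h2 : LinearMap.adjoint (τ g) = τ g⁻¹ := by
    symm
    rw [LinearMap.eq_adjoint_iff]
    intro x y
    rw [hτ.inner_apply_left, inv_inv]
  rw [h2] at h
  exact h

theorem IsUnitaryRep.conj_orthProj {τ : Representation ℂ G W} (hτ : IsUnitaryRep τ) (g : G)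
    (M : Submodule ℂ W) : τ g * orthProj M * τ g⁻¹ = orthProj (M.map (τ g)) :=
  orthProj_map _ _ (hτ g) (rep_mul_inv τ g) M

theorem IsUnitaryRep.commute_orthProj {τ : Representation ℂ G W} (hτ : IsUnitaryRep τ) {g : G}
    {M : Submodule ℂ W} (hM : M.map (τ g) = M) : Commute (orthProj M) (τ g) := by
  have h := hτ.conj_orthProj g M
  rw [hM] at h
  calc orthProj M * τ g = τ g * orthProj M * τ g⁻¹ * τ g := by rw [h]
    _ = τ g * orthProj M := by rw [mul_assoc, rep_inv_mul, mul_one]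

/-- The probability that measuring `τ a ψ` with the POVM `E` gives the outcome `f a`, for `a`
uniform in `G`. This is the success probability of an algorithm which applies no unitary after the query,
for the action `τ` of the oracle on the joint space. -/
noncomputable def averageSuccess {X : Type*} [Fintype G] (τ : Representation ℂ G W)
    (E : X → (W →ₗ[ℂ] W)) (f : G → X) (ψ : W) : ℝ :=
  (1 / (Fintype.card G : ℝ)) * ∑ a : G, (inner ℂ (τ a ψ) (E (f a) (τ a ψ))).re

end Unitary

/-! ### Minimal invariant subspaces -/

section Minimal

theorem exists_minimal_invariant {H A : Type*} [Group H] [AddCommGroup A] [Module ℂ A]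
    [FiniteDimensional ℂ A] (α : Representation ℂ H A) (K : Submodule ℂ A)
    (hK : ∀ h : H, ∀ v ∈ K, α h v ∈ K) (hK0 : K ≠ ⊥) :
    ∃ Y ≤ K, Y ≠ ⊥ ∧ (∀ h : H, ∀ v ∈ Y, α h v ∈ Y) ∧
      ∀ Z ≤ Y, (∀ h : H, ∀ v ∈ Z, α h v ∈ Z) → Z = ⊥ ∨ Z = Y := by
  let s : Set (Submodule ℂ A) := {Y | Y ≤ K ∧ Y ≠ ⊥ ∧ ∀ h : H, ∀ v ∈ Y, α h v ∈ Y}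
  obtain ⟨Y, hY⟩ := exists_minimal_of_wellFoundedLT (· ∈ s) ⟨K, le_rfl, hK0, hK⟩
  refine ⟨Y, hY.1.1, hY.1.2.1, hY.1.2.2, fun Z hZ hZi => ?_⟩
  by_cases h0 : Z = ⊥
  · exact Or.inl h0
  · exact Or.inr (le_antisymm hZ (hY.2 ⟨hZ.trans hY.1.1, h0, hZi⟩ hZ))

theorem isIrreducible_of_minimal_range {H A S : Type*} [Group H] [AddCommGroup A] [Module ℂ A]
    [AddCommGroup S] [Module ℂ S] {α : Representation ℂ H A} {ρ : Representation ℂ H S}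
    (m : S →ₗ[ℂ] A) (hm : ∀ h s, m (ρ h s) = α h (m s)) (hinj : Function.Injective m)
    (h0 : LinearMap.range m ≠ ⊥)
    (hmin : ∀ Z ≤ LinearMap.range m, (∀ h : H, ∀ v ∈ Z, α h v ∈ Z) →
      Z = ⊥ ∨ Z = LinearMap.range m) :
    ρ.IsIrreducible := by
  have hne : (⊥ : Subrepresentation ρ) ≠ ⊤ := by
    intro h
    apply h0
    have h1 : (⊥ : Submodule ℂ S) = ⊤ := congrArg Subrepresentation.toSubmodule h
    rw [LinearMap.range_eq_map, ← h1, Submodule.map_bot]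
  refine { exists_pair_ne := ⟨⊥, ⊤, hne⟩, eq_bot_or_eq_top := fun κ => ?_ }
  rcases hmin (κ.toSubmodule.map m) (LinearMap.map_le_range) (by
    rintro h _ ⟨v, hv, rfl⟩
    exact ⟨ρ h v, κ.apply_mem_toSubmodule h hv, hm h v⟩) with h | h
  · left
    apply Subrepresentation.toSubmodule_injective
    exact Submodule.map_injective_of_injective hinj (h.trans (Submodule.map_bot m).symm)
  · right
    apply Subrepresentation.toSubmodule_injective
    rw [LinearMap.range_eq_map] at h
    exact Submodule.map_injective_of_injective hinj h

end Minimal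

/-! ### The upper bound for a fixed joint space -/

section Upper

variable {G X W : Type*} [Group G] [Fintype G] [NormedAddCommGroup W] [InnerProductSpace ℂ W]
  [FiniteDimensional ℂ W] [Fintype X] [MulAction G X] [MulAction.IsPretransitive G X]

/-- The success probability of a POVM is bounded by `dim (G Y) / ([G : H] dim Y)` for a minimal
`H`-invariant subspace `Y`, which is found in the eigenspace for the largest eigenvalue of the
averaged measurement operator `|G|⁻¹ ∑ a, τ(a)⁻¹ E_{a x₀} τ(a)`. -/
theorem averageSuccess_upper {τ : Representation ℂ G W} (hτ : IsUnitaryRep τ)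
    (E : X → (W →ₗ[ℂ] W)) (hE : ∀ x, (E x).IsPositive) (hE1 : ∑ x, E x = 1)
    (f : G → X) (hf : ∀ g h : G, f (g * h) = g • f h) (x₀ : X) (ψ : W) (hψ : ‖ψ‖ = 1) :
    ∃ Y : Submodule ℂ W, Y ≠ ⊥ ∧
      (∀ h : MulAction.stabilizer G x₀, ∀ v ∈ Y, τ h v ∈ Y) ∧
      (∀ Z ≤ Y, (∀ h : MulAction.stabilizer G x₀, ∀ v ∈ Z, τ h v ∈ Z) → Z = ⊥ ∨ Z = Y) ∧
      averageSuccess τ E f ψ * (Fintype.card X * Module.finrank ℂ Y) ≤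
        Module.finrank ℂ (repSpan τ Y) := by
  obtain ⟨k, hk⟩ := MulAction.exists_smul_eq G x₀ (f 1)
  have hfa (a : G) : f a = (a * k) • x₀ := by
    rw [mul_smul, hk, ← hf, mul_one]
  have hcG : (Fintype.card G : ℝ) ≠ 0 := by exact_mod_cast Fintype.card_ne_zero
  set c : ℝ := 1 / (Fintype.card G : ℝ) with hc
  have hc0 : 0 ≤ c := by positivity
  -- The success probability is the expectation of the averaged operator `Eb`.
  set Eb : W →ₗ[ℂ] W := (c : ℂ) • ∑ a : G, τ a⁻¹ * E (a • x₀) * τ a with hEb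
  have hEbpos : Eb.IsPositive := by
    refine LinearMap.IsPositive.smul_of_nonneg ?_ (by exact_mod_cast hc0)
    exact LinearMap.isPositive_sum _ fun a _ => hτ.isPositive_conj a (hE _)
  set ψ' : W := τ k⁻¹ ψ with hψ'
  have hp : averageSuccess τ E f ψ = (inner ℂ ψ' (Eb ψ')).re := by
    have h1 : inner ℂ ψ' (Eb ψ') =
        (c : ℂ) * ∑ a : G, inner ℂ (τ a ψ') (E (a • x₀) (τ a ψ')) := by
      rw [hEb, LinearMap.smul_apply, inner_smul_right, LinearMap.sum_apply, inner_sum]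
      congr 1
      refine Finset.sum_congr rfl fun a _ => ?_
      simp only [Module.End.mul_apply]
      exact (hτ.inner_apply_left a ψ' _).symm
    rw [h1, Complex.re_ofReal_mul, Complex.re_sum, averageSuccess]
    congr 1
    refine Fintype.sum_equiv (Equiv.mulRight k) _ _ fun a => ?_
    have h2 : τ (a * k) ψ' = τ a ψ := by
      rw [hψ', ← Module.End.mul_apply, ← map_mul, mul_inv_cancel_right]
    rw [Equiv.coe_mulRight, h2, hfa]
  obtain ⟨l, hl, hl'⟩ := exists_hasEigenvalue_ge Eb hEbpos.isSymmetric ψ'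
    (by rw [hψ', hτ.norm_apply, hψ])
  have hcomm (h : MulAction.stabilizer G x₀) : τ h * Eb = Eb * τ h := by
    rw [hEb, mul_smul_comm, smul_mul_assoc, Finset.mul_sum, Finset.sum_mul]
    congr 1
    refine Fintype.sum_equiv (Equiv.mulRight (h : G)⁻¹) _ _ fun a => ?_
    have h3 : (h : G)⁻¹ • x₀ = x₀ := (h⁻¹).2
    rw [Equiv.coe_mulRight, mul_smul, h3, mul_inv_rev, inv_inv, map_mul, map_mul]
    simp only [mul_assoc]
    rw [rep_inv_mul, mul_one]
  obtain ⟨Y, hYK, hY0, hYi, hYm⟩ := exists_minimal_invariant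
    (τ.comp (MulAction.stabilizer G x₀).subtype) (Module.End.eigenspace Eb (l : ℂ))
    (by
      intro h v hv
      rw [Module.End.mem_eigenspace_iff] at hv ⊢
      change Eb (τ h v) = _ • τ h v
      rw [← Module.End.mul_apply, ← hcomm, Module.End.mul_apply, hv, map_smul]) hl'
  refine ⟨Y, hY0, hYi, hYm, ?_⟩
  -- The projection onto the span `G Y` commutes with `τ`, so averaging leaves the trace unchanged
  -- and the completeness relation `∑ x, E x = 1` can be applied.
  have htr : (LinearMap.trace ℂ W (Eb * orthProj (repSpan τ Y))).re * Fintype.card X =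
      Module.finrank ℂ (repSpan τ Y) := by
    have h1 (a : G) : LinearMap.trace ℂ W (τ a⁻¹ * E (a • x₀) * τ a * orthProj (repSpan τ Y)) =
        LinearMap.trace ℂ W (E (a • x₀) * orthProj (repSpan τ Y)) := by
      rw [mul_assoc, ← (hτ.commute_orthProj (map_repSpan τ Y a)).eq, ← mul_assoc,
        LinearMap.trace_mul_comm, mul_assoc, ← mul_assoc, rep_mul_inv, one_mul]
    have h2 := card_smul_sum_orbit (G := G) x₀
      fun x => LinearMap.trace ℂ W (E x * orthProj (repSpan τ Y))
    rw [← map_sum _ (fun x => E x * _), ← Finset.sum_mul, hE1, one_mul, trace_orthProj,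
      nsmul_eq_mul, nsmul_eq_mul] at h2
    have h3 : LinearMap.trace ℂ W (Eb * orthProj (repSpan τ Y)) * Fintype.card X =
        (Module.finrank ℂ (repSpan τ Y) : ℂ) := by
      rw [hEb, smul_mul_assoc, Finset.sum_mul, map_smul, map_sum]
      simp only [h1]
      rw [smul_eq_mul, mul_assoc, mul_comm (Finset.sum _ _), h2, hc]
      have hcG' : (Fintype.card G : ℂ) ≠ 0 := by exact_mod_cast hcG
      push_cast
      field_simp
    have h4 := congrArg Complex.re h3
    simpa using h4
  have hmain := finrank_mul_le_re_trace Eb hEbpos (le_repSpan τ Y) (c := l)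
    (fun y hy => Module.End.mem_eigenspace_iff.mp (hYK hy))
  rw [← htr, hp]
  calc _ ≤ l * (Fintype.card X * Module.finrank ℂ Y) := by gcongr
    _ = (l * Module.finrank ℂ Y) * Fintype.card X := by ring
    _ ≤ _ := by gcongr

end Upper

/-! ### Optimal measurements on a fixed joint space -/

section Lower

section
variable {W : Type*} [NormedAddCommGroup W] [InnerProductSpace ℂ W] [FiniteDimensional ℂ W]

theorem re_inner_orthProj (M : Submodule ℂ W) (v : W) :
    (inner ℂ v (orthProj M v)).re = ‖orthProj M v‖ ^ 2 := by
  rw [← (orthProj_isPositive M).isSymmetric v v]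
  exact M.re_inner_starProjection_eq_normSq v

theorem orthProj_orthogonal (M : Submodule ℂ W) : orthProj Mᗮ = 1 - orthProj M := by
  ext v
  rw [orthProj, M.starProjection_orthogonal']
  rfl

omit [FiniteDimensional ℂ W] in
theorem re_inner_nonneg {E : W →ₗ[ℂ] W} (hE : E.IsPositive) (v : W) :
    0 ≤ (inner ℂ v (E v)).re := hE.re_inner_nonneg_right v

/-- The trace of `P_B R²` is the sum of `‖R b‖²` over an orthonormal basis of `B`, so some basis
vector contributes at least the average. -/
theorem exists_unit_re_trace_le (R : W →ₗ[ℂ] W) (hR : R.IsSymmetric) (B : Submodule ℂ W)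
    (hB : B ≠ ⊥) :
    ∃ b ∈ B, ‖b‖ = 1 ∧
      (LinearMap.trace ℂ W (orthProj B * (R * R))).re ≤ ‖R b‖ ^ 2 * Module.finrank ℂ B := by
  let e := stdOrthonormalBasis ℂ B
  let pr : W →ₗ[ℂ] B := (B.orthogonalProjectionOnto : W →ₗ[ℂ] B)
  have h1 : LinearMap.trace ℂ W (orthProj B * (R * R)) =
      LinearMap.trace ℂ B (pr ∘ₗ (R * R) ∘ₗ B.subtype) := by
    exact LinearMap.trace_comp_comm' (pr ∘ₗ (R * R)) B.subtype
  have h2 : (LinearMap.trace ℂ W (orthProj B * (R * R))).re = ∑ i, ‖R (e i)‖ ^ 2 := by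
    rw [h1, LinearMap.trace_eq_sum_inner _ e, Complex.re_sum]
    refine Finset.sum_congr rfl fun i _ => ?_
    have h3 : inner ℂ (e i) ((pr ∘ₗ (R * R) ∘ₗ B.subtype) (e i)) =
        inner ℂ (e i : W) (R (R (e i))) :=
      Submodule.inner_orthogonalProjectionOnto_eq_of_mem_left (K := B) (e i) _
    rw [h3, ← hR]
    exact (norm_sq_eq_re_inner (𝕜 := ℂ) (R (e i))).symm
  have hn : 0 < Module.finrank ℂ B := by
    rw [Module.finrank_pos_iff]
    exact (Submodule.nontrivial_iff_ne_bot).mpr hB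
  have : Nonempty (Fin (Module.finrank ℂ B)) := ⟨⟨0, hn⟩⟩
  obtain ⟨i, -, hi⟩ := Finset.exists_max_image Finset.univ (fun i => ‖R (e i)‖ ^ 2)
    Finset.univ_nonempty
  refine ⟨e i, (e i).2, e.orthonormal.1 i, ?_⟩
  rw [h2]
  calc ∑ j, ‖R (e j)‖ ^ 2 ≤ ∑ j : Fin (Module.finrank ℂ B), ‖R (e i)‖ ^ 2 :=
        Finset.sum_le_sum fun j hj => hi j hj
    _ = _ := by simp [mul_comm]
end

variable {G X W : Type*} [Group G] [Fintype G] [NormedAddCommGroup W] [InnerProductSpace ℂ W]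
  [FiniteDimensional ℂ W] [Fintype X] [MulAction G X] [MulAction.IsPretransitive G X]

/-- For every `H`-invariant subspace `B ≠ 0` some POVM and some input state succeed with probability
at least `dim (G B) / ([G : H] dim B)`. The POVM is the square-root measurement for the subspaces
`g B`: with `F x` the projection onto `s(x) B`, where `s(x) x₀ = x`, and `K` the projection onto the
orthogonal complement of `G B`, the operators are `R (F x) R + K / |X|` for
`R = (∑ x, F x + K)^(-1/2)`. -/
theorem averageSuccess_lower {τ : Representation ℂ G W} (hτ : IsUnitaryRep τ)
    (f : G → X) (hf : ∀ g h : G, f (g * h) = g • f h) (x₀ : X)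
    (B : Submodule ℂ W) (hB0 : B ≠ ⊥)
    (hB : ∀ h : MulAction.stabilizer G x₀, ∀ v ∈ B, τ h v ∈ B) :
    ∃ E : X → (W →ₗ[ℂ] W), (∀ x, (E x).IsPositive) ∧ ∑ x, E x = 1 ∧ ∃ ψ : W, ‖ψ‖ = 1 ∧
      (Module.finrank ℂ (repSpan τ B) : ℝ) ≤
        averageSuccess τ E f ψ * (Fintype.card X * Module.finrank ℂ B) := by
  have : Nonempty X := ⟨x₀⟩
  have hcX : (Fintype.card X : ℂ) ≠ 0 := by exact_mod_cast Fintype.card_ne_zero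
  obtain ⟨k, hk⟩ := MulAction.exists_smul_eq G x₀ (f 1)
  have hfa (a : G) : f a = (a * k) • x₀ := by
    rw [mul_smul, hk, ← hf, mul_one]
  choose s hs using MulAction.exists_smul_eq G x₀
  -- By the invariance of `B` under `H`, the subspace `g B` depends only on `g • x₀`.
  have hle (g g' : G) (h : g • x₀ = g' • x₀) : B.map (τ g) ≤ B.map (τ g') := by
    rintro _ ⟨v, hv, rfl⟩
    have hm : g'⁻¹ * g ∈ MulAction.stabilizer G x₀ := by
      rw [MulAction.mem_stabilizer_iff, mul_smul, h, inv_smul_smul]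
    refine ⟨τ (g'⁻¹ * g) v, hB ⟨_, hm⟩ v hv, ?_⟩
    rw [← Module.End.mul_apply, ← map_mul, mul_inv_cancel_left]
  have hmap (g g' : G) (h : g • x₀ = g' • x₀) : B.map (τ g) = B.map (τ g') :=
    le_antisymm (hle g g' h) (hle g' g h.symm)
  set M := repSpan τ B with hM
  set F : X → (W →ₗ[ℂ] W) := fun x => orthProj (B.map (τ (s x))) with hF
  set K : W →ₗ[ℂ] W := orthProj Mᗮ with hK
  have hFcov (g : G) (x : X) : τ g * F x * τ g⁻¹ = F (g • x) := by
    simp only [hF]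
    rw [hτ.conj_orthProj, ← Submodule.map_comp]
    have : B.map (τ g ∘ₗ τ (s x)) = B.map (τ (s (g • x))) := by
      have h2 : τ g ∘ₗ τ (s x) = τ (g * s x) := (map_mul τ _ _).symm
      rw [h2]
      exact hmap _ _ (by rw [mul_smul, hs, hs])
    rw [this]
  have hKcov (g : G) : Commute K (τ g) := by
    rw [hK, orthProj_orthogonal]
    exact (Commute.one_left _).sub_left (hτ.commute_orthProj (map_repSpan τ B g))
  set S : W →ₗ[ℂ] W := ∑ x, F x + K with hS
  have hFpos (x : X) : (F x).IsPositive := orthProj_isPositive _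
  have hKpos : K.IsPositive := orthProj_isPositive _
  have hSpos : S.IsPositive := (LinearMap.isPositive_sum _ fun x _ => hFpos x).add hKpos
  have hSinj : Function.Injective S := by
    rw [← LinearMap.ker_eq_bot, LinearMap.ker_eq_bot']
    intro v hv
    have h1 : ∑ x, (inner ℂ v (F x v)).re + (inner ℂ v (K v)).re = 0 := by
      rw [← Complex.re_sum, ← inner_sum, ← LinearMap.sum_apply, ← Complex.add_re, ← inner_add_right,
        ← LinearMap.add_apply, ← hS, hv, inner_zero_right, Complex.zero_re]
    have hFn (x : X) : 0 ≤ (inner ℂ v (F x v)).re := re_inner_nonneg (hFpos x) v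
    have hKn : 0 ≤ (inner ℂ v (K v)).re := re_inner_nonneg hKpos v
    have h2 : ∑ x, (inner ℂ v (F x v)).re = 0 :=
      le_antisymm (by linarith) (Finset.sum_nonneg fun x _ => hFn x)
    have hFv (x : X) : v ∈ (B.map (τ (s x)))ᗮ := by
      have h3 := (Finset.sum_eq_zero_iff_of_nonneg fun x _ => hFn x).mp h2 x (Finset.mem_univ x)
      rw [re_inner_orthProj, sq_eq_zero_iff, norm_eq_zero] at h3
      exact (Submodule.starProjection_apply_eq_zero_iff _).mp h3
    have hKv : v ∈ M := by
      have h3 : (inner ℂ v (K v)).re = 0 := by linarith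
      rw [re_inner_orthProj, sq_eq_zero_iff, norm_eq_zero] at h3
      rw [← M.orthogonal_orthogonal]
      exact (Submodule.starProjection_apply_eq_zero_iff _).mp h3
    have hMv : v ∈ Mᗮ := by
      rw [hM, repSpan, ← Submodule.iInf_orthogonal, Submodule.mem_iInf]
      intro g
      rw [hmap g (s (g • x₀)) (hs _).symm]
      exact hFv _
    exact Submodule.disjoint_def.mp M.orthogonal_disjoint v hKv hMv
  obtain ⟨R, hRpos, hRSR, hRcomm⟩ := exists_isPositive_invSqrt S hSpos hSinj
  have hRs := hRpos.isSymmetric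
  have hRτ (g : G) : Commute R (τ g) := by
    refine hRcomm _ (Commute.add_left ?_ (hKcov g))
    have h1 : τ g * (∑ x, F x) * τ g⁻¹ = ∑ x, F x := by
      rw [Finset.mul_sum, Finset.sum_mul]
      exact Fintype.sum_equiv (MulAction.toPerm g) _ _ fun x => hFcov g x
    change (∑ x, F x) * τ g = τ g * ∑ x, F x
    calc (∑ x, F x) * τ g = τ g * (∑ x, F x) * τ g⁻¹ * τ g := by rw [h1]
      _ = τ g * ∑ x, F x := by rw [mul_assoc, rep_inv_mul, mul_one]
  have hFM (x : X) : B.map (τ (s x)) ≤ M := le_iSup (fun g => B.map (τ g)) (s x)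
  have hFK (x : X) : F x * K = 0 := by
    rw [hK, orthProj_orthogonal, mul_sub, mul_one, orthProj_mul_of_le' (hFM x), sub_self]
  have hKF (x : X) : K * F x = 0 := by
    rw [hK, orthProj_orthogonal, sub_mul, one_mul, orthProj_mul_of_le (hFM x), sub_self]
  have hSK : S * K = K := by
    rw [hS, add_mul, Finset.sum_mul, Finset.sum_eq_zero fun x _ => hFK x, zero_add,
      orthProj_mul_self]
  have hKS : K * S = K := by
    rw [hS, mul_add, Finset.mul_sum, Finset.sum_eq_zero fun x _ => hKF x, zero_add,
      orthProj_mul_self]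
  -- `S` is the identity on the range of `K`, hence so is `R`.
  have hRK : R * K * R = K := by
    have h1 : R * K = K * R := hRcomm K (hSK.trans hKS.symm)
    have h2 : R * S = S * R := hRcomm S (Commute.refl S)
    calc R * K * R = R * (K * R) := mul_assoc _ _ _
      _ = R * (R * K) := by rw [h1]
      _ = R * (R * (S * K)) := by rw [hSK]
      _ = R * (R * S) * K := by simp only [mul_assoc]
      _ = R * (S * R) * K := by rw [h2]
      _ = R * S * R * K := by simp only [mul_assoc]
      _ = K := by rw [hRSR, one_mul]
  have hRF : ∑ x, R * F x * R = orthProj M := by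
    have h1 : R * (∑ x, F x) * R = 1 - K := by
      rw [eq_sub_iff_add_eq, ← hRSR, hS, mul_add, add_mul, hRK]
    rw [← Finset.sum_mul, ← Finset.mul_sum, h1, hK, orthProj_orthogonal, sub_sub_cancel]
  have hFx₀ : F x₀ = orthProj B := by
    simp only [hF]
    rw [hmap (s x₀) 1 (by rw [hs, one_smul]), map_one]
    congr 2
    exact B.map_id
  have hRFcov (g : G) (x : X) : R * F (g • x) * R = τ g * (R * F x * R) * τ g⁻¹ := by
    rw [← hFcov]
    have h1 := (hRτ g).eq
    have h2 := (hRτ g⁻¹).eq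
    calc R * (τ g * F x * τ g⁻¹) * R = (R * τ g) * F x * (τ g⁻¹ * R) := by simp only [mul_assoc]
      _ = (τ g * R) * F x * (R * τ g⁻¹) := by rw [h1, h2]
      _ = _ := by simp only [mul_assoc]
  -- By covariance, all the operators `R (F x) R` have the same trace, and they add up to `P_M`.
  have htr : (Fintype.card X : ℝ) * (LinearMap.trace ℂ W (orthProj B * (R * R))).re =
      Module.finrank ℂ M := by
    have h1 (x : X) : LinearMap.trace ℂ W (R * F x * R) =
        LinearMap.trace ℂ W (orthProj B * (R * R)) := by
      rw [← hs x, hRFcov, LinearMap.trace_mul_cycle, rep_inv_mul, one_mul, hFx₀,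
        LinearMap.trace_mul_comm, ← mul_assoc, LinearMap.trace_mul_comm]
    have h2 := congrArg (LinearMap.trace ℂ W) hRF
    rw [map_sum, Finset.sum_congr rfl fun x _ => h1 x, trace_orthProj, Finset.sum_const,
      Finset.card_univ, nsmul_eq_mul] at h2
    have h3 := congrArg Complex.re h2
    simpa using h3
  obtain ⟨b, hbB, hb1, hb⟩ := exists_unit_re_trace_le R hRs B hB0
  have hRb : R b ≠ 0 := by
    intro h0
    have h1 : (R * S * R) b = b := by rw [hRSR]; rfl
    rw [Module.End.mul_apply, h0, map_zero] at h1
    rw [← h1, norm_zero] at hb1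
    exact zero_ne_one hb1
  have hRb' : 0 < ‖R b‖ := norm_pos_iff.mpr hRb
  set E : X → (W →ₗ[ℂ] W) := fun x => R * F x * R + (Fintype.card X : ℂ)⁻¹ • K with hE
  -- The expectation of `R P_B R` in the normalization of `R b` is at least `‖R b‖²`.
  set ψ' : W := ((‖R b‖⁻¹ : ℝ) : ℂ) • R b with hψ'
  have hψ'1 : ‖ψ'‖ = 1 := by
    rw [hψ', norm_smul, Complex.norm_real, norm_inv, norm_norm, inv_mul_cancel₀ hRb'.ne']
  have hKc : ((Fintype.card X : ℂ)⁻¹ • K).IsPositive := by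
    have h1 : (0 : ℝ) ≤ (Fintype.card X : ℝ)⁻¹ := by positivity
    have h2 : (Fintype.card X : ℂ)⁻¹ = (((Fintype.card X : ℝ)⁻¹ : ℝ) : ℂ) := by push_cast; rfl
    rw [h2]
    exact hKpos.smul_of_nonneg (by exact_mod_cast h1)
  have hEcov (g : G) (x : X) : E (g • x) = τ g * E x * τ g⁻¹ := by
    simp only [hE]
    rw [mul_add, add_mul, hRFcov, mul_smul_comm, smul_mul_assoc, ← (hKcov g).eq, mul_assoc K,
      rep_mul_inv, mul_one]
  refine ⟨E, fun x => (isPositive_conj_of_isSymmetric hRs (hFpos x)).add hKc, ?_, τ k ψ', ?_, ?_⟩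
  · rw [Finset.sum_add_distrib, hRF, Finset.sum_const, Finset.card_univ, ← Nat.cast_smul_eq_nsmul ℂ,
      smul_smul, mul_inv_cancel₀ hcX, one_smul, hK, orthProj_orthogonal, add_sub_cancel]
  · rw [hτ.norm_apply, hψ'1]
  · have hval : averageSuccess τ E f (τ k ψ') = (inner ℂ ψ' (E x₀ ψ')).re := by
      have h1 (a : G) : (inner ℂ (τ a (τ k ψ')) (E (f a) (τ a (τ k ψ')))).re =
          (inner ℂ ψ' (E x₀ ψ')).re := by
        rw [← Module.End.mul_apply, ← map_mul, hfa, hEcov]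
        simp only [Module.End.mul_apply]
        rw [hτ, ← Module.End.mul_apply (τ _⁻¹), rep_inv_mul, Module.End.one_apply]
      rw [averageSuccess, Finset.sum_congr rfl fun a _ => h1 a, Finset.sum_const, Finset.card_univ,
        nsmul_eq_mul, ← mul_assoc, one_div, inv_mul_cancel₀, one_mul]
      exact_mod_cast Fintype.card_ne_zero
    have hge : ‖R b‖ ^ 2 ≤ (inner ℂ ψ' (E x₀ ψ')).re := by
      have h1 : (inner ℂ ψ' (E x₀ ψ')).re =
          ‖orthProj B (R ψ')‖ ^ 2 + (inner ℂ ψ' (((Fintype.card X : ℂ)⁻¹ • K) ψ')).re := by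
        rw [← re_inner_orthProj, ← Complex.add_re, ← hFx₀]
        simp only [hE]
        rw [LinearMap.add_apply, inner_add_right, hRs]
        rfl
      have h2 : ‖R b‖ ≤ ‖orthProj B (R ψ')‖ := by
        have h3 : inner ℂ b (orthProj B (R ψ')) = (‖R b‖ : ℂ) := by
          rw [← (orthProj_isPositive B).isSymmetric,
            show orthProj B b = b from B.starProjection_eq_self_iff.mpr hbB, ← hRs, hψ',
            inner_smul_right, inner_self_eq_norm_sq_to_K]
          have : (‖R b‖ : ℂ) ≠ 0 := by exact_mod_cast hRb'.ne'
          push_cast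
          field_simp
          rfl
        calc ‖R b‖ = ‖inner ℂ b (orthProj B (R ψ'))‖ := by rw [h3]; simp
          _ ≤ ‖b‖ * ‖orthProj B (R ψ')‖ := norm_inner_le_norm _ _
          _ = _ := by rw [hb1, one_mul]
      have h4 := re_inner_nonneg hKc ψ'
      rw [h1]
      have h5 : ‖R b‖ ^ 2 ≤ ‖orthProj B (R ψ')‖ ^ 2 := by gcongr
      linarith
    rw [hval, ← htr]
    calc _ ≤ (Fintype.card X : ℝ) * (‖R b‖ ^ 2 * Module.finrank ℂ B) := by gcongr
      _ ≤ (Fintype.card X : ℝ) * ((inner ℂ ψ' (E x₀ ψ')).re * Module.finrank ℂ B) := by gcongr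
      _ = _ := by ring

end Lower

/-! ### Complete reducibility -/

section Maschke

variable {G A S : Type*} [Group G] [Fintype G] [AddCommGroup A] [Module ℂ A] [AddCommGroup S]
  [Module ℂ S]

/-- Maschke's theorem: average an arbitrary linear left inverse over the group. -/
theorem exists_equivariant_leftInverse {ρ : Representation ℂ G S} {α : Representation ℂ G A}
    (m : S →ₗ[ℂ] A) (hm : ∀ g s, m (ρ g s) = α g (m s)) (hinj : Function.Injective m) :
    ∃ r : A →ₗ[ℂ] S, (∀ g a, r (α g a) = ρ g (r a)) ∧ ∀ s, r (m s) = s := by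
  obtain ⟨r₀, hr₀⟩ := m.exists_leftInverse_of_injective (LinearMap.ker_eq_bot.mpr hinj)
  have hr₀' (s : S) : r₀ (m s) = s := LinearMap.congr_fun hr₀ s
  have hc : (Fintype.card G : ℂ) ≠ 0 := by exact_mod_cast Fintype.card_ne_zero
  refine ⟨(Fintype.card G : ℂ)⁻¹ • ∑ g : G, ρ g⁻¹ ∘ₗ r₀ ∘ₗ α g, fun g a => ?_, fun s => ?_⟩
  · simp only [LinearMap.smul_apply, LinearMap.sum_apply, LinearMap.comp_apply, map_smul, map_sum]
    congr 1
    refine Fintype.sum_equiv (Equiv.mulRight g) _ _ fun h => ?_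
    simp [← Module.End.mul_apply, ← map_mul]
  · simp only [LinearMap.smul_apply, LinearMap.sum_apply, LinearMap.comp_apply, ← hm, hr₀']
    have h (g : G) : ρ g⁻¹ (ρ g s) = s := by simp [← Module.End.mul_apply, ← map_mul]
    simp only [h, Finset.sum_const, Finset.card_univ]
    rw [← Nat.cast_smul_eq_nsmul ℂ, smul_smul, inv_mul_cancel₀ hc, one_smul]

end Maschke

/-! ### The action on the joint space -/

section Amplification

variable {G V : Type*} [Group G] [NormedAddCommGroup V] [InnerProductSpace ℂ V] {N : ℕ}

/-- The action `g ↦ π(g) ⊗ I` on `V ⊗ ℂᴺ`. -/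
noncomputable def amplify (π : Representation ℂ G V) (N : ℕ) :
    Representation ℂ G (Register V N) where
  toFun g := TensorProduct.map (π g) LinearMap.id
  map_one' := by rw [map_one]; exact TensorProduct.map_id
  map_mul' g h := by
    rw [map_mul]
    ext v w
    rfl

theorem amplify_apply (π : Representation ℂ G V) (N : ℕ) (g : G) :
    amplify π N g = TensorProduct.map (π g) LinearMap.id := rfl

theorem amplify_isUnitaryRep {π : Representation ℂ G V} (hπ : IsUnitaryRep π) (N : ℕ) :
    IsUnitaryRep (amplify π N) := by
  intro g v w
  let i : V →ₗᵢ[ℂ] V := LinearMap.isometryOfInner (π g) (hπ g)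
  exact TensorProduct.inner_map_map i LinearIsometry.id v w

variable (V) in
/-- The `i`-th component of a vector of `V ⊗ ℂᴺ ≅ Vᴺ`. -/
noncomputable def component (i : Fin N) : Register V N →ₗ[ℂ] V :=
  (TensorProduct.rid ℂ V).toLinearMap ∘ₗ
    TensorProduct.map LinearMap.id (EuclideanSpace.proj i : EuclideanSpace ℂ (Fin N) →L[ℂ] ℂ)

theorem component_tmul (i : Fin N) (v : V) (e : EuclideanSpace ℂ (Fin N)) :
    component V i (v ⊗ₜ e) = e i • v := by
  simp [component]

theorem component_amplify (π : Representation ℂ G V) (g : G) (i : Fin N) (w : Register V N) :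
    component V i (amplify π N g w) = π g (component V i w) := by
  induction w using TensorProduct.induction_on with
  | zero => simp
  | tmul v e => simp [amplify_apply, component_tmul]
  | add x y hx hy => simp [map_add, hx, hy]

theorem eq_zero_of_component_eq_zero (w : Register V N) (h : ∀ i, component V i w = 0) :
    w = 0 := by
  have h1 : w = ∑ i, component V i w ⊗ₜ EuclideanSpace.single i (1 : ℂ) := by
    clear h
    induction w using TensorProduct.induction_on with
    | zero => simp
    | tmul v e =>
      simp only [component_tmul, TensorProduct.smul_tmul]
      rw [← TensorProduct.tmul_sum]
      congr 1
      ext j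
      simp [Pi.single_apply]
    | add x y hx hy =>
      conv_lhs => rw [hx, hy]
      simp only [map_add, TensorProduct.add_tmul, Finset.sum_add_distrib]
  rw [h1]
  simp [h]

end Amplification

/-! ### The shared part and equivariant maps -/

section Shared

variable {G A V : Type*} [Group G] [Fintype G] [AddCommGroup A] [Module ℂ A]
  [FiniteDimensional ℂ A] [NormedAddCommGroup V] [InnerProductSpace ℂ V]

omit [Fintype G] [FiniteDimensional ℂ A] in
/-- A minimal invariant subspace on which some equivariant map to `β` does not vanish is one of the
subrepresentations which span the shared part: the equivariant map is injective on it. -/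
theorem le_sharedPart {B : Type*} [AddCommGroup B] [Module ℂ B] {α : Representation ℂ G A}
    {β : Representation ℂ G B} (S : Submodule ℂ A)
    (hS0 : S ≠ ⊥) (hS : ∀ g : G, ∀ v ∈ S, α g v ∈ S)
    (hmin : ∀ Z ≤ S, (∀ h : G, ∀ v ∈ Z, α h v ∈ Z) → Z = ⊥ ∨ Z = S)
    (j : A →ₗ[ℂ] B) (hj : ∀ g a, j (α g a) = β g (j a)) (hj0 : ∃ v ∈ S, j v ≠ 0) :
    S ≤ sharedPart α β := by
  let σ : Subrepresentation α := ⟨S, fun g v hv => hS g v hv⟩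
  let m : S →ₗ[ℂ] B := j ∘ₗ S.subtype
  have hm : Function.Injective m := by
    rw [← LinearMap.ker_eq_bot, LinearMap.ker_eq_bot']
    intro v hv
    rcases hmin (S ⊓ LinearMap.ker j) inf_le_left (by
      rintro g w ⟨hw, hw'⟩
      refine ⟨hS g w hw, ?_⟩
      rw [SetLike.mem_coe, LinearMap.mem_ker] at hw' ⊢
      rw [hj, hw', map_zero]) with h | h
    · have : (v : A) ∈ S ⊓ LinearMap.ker j := ⟨v.2, hv⟩
      rw [h, Submodule.mem_bot] at this
      exact Subtype.ext this
    · obtain ⟨w, hw, hw0⟩ := hj0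
      rw [← h] at hw
      exact absurd hw.2 hw0
  let τ : Subrepresentation β := ⟨LinearMap.range m, by
    rintro g _ ⟨v, rfl⟩
    exact ⟨⟨α g v, hS g v v.2⟩, hj g v⟩⟩
  refine le_sSup ⟨σ, ?_, ⟨τ, ⟨?_⟩⟩, rfl⟩
  · refine isIrreducible_of_minimal_range (α := α) S.subtype (fun _ _ => rfl)
      S.subtype_injective ?_ ?_
    · rwa [Submodule.range_subtype]
    · rwa [Submodule.range_subtype]
  · refine Representation.Equiv.mk (LinearEquiv.ofInjective m hm) fun g => ?_
    ext v
    exact hj g v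

omit [Fintype G] [FiniteDimensional ℂ A] in
theorem sharedPart_invariant {B : Type*} [AddCommGroup B] [Module ℂ B] (α : Representation ℂ G A)
    (β : Representation ℂ G B) (g : G) (v : A) (hv : v ∈ sharedPart α β) :
    α g v ∈ sharedPart α β := by
  have h : sharedPart α β ≤ (sharedPart α β).comap (α g) := by
    refine sSup_le ?_
    rintro S ⟨σ, h1, h2, rfl⟩ v hv
    exact (le_sSup (a := σ.toSubmodule) (by exact ⟨σ, h1, h2, rfl⟩) :
      σ.toSubmodule ≤ sharedPart α β) (σ.apply_mem_toSubmodule g hv)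
  exact h hv

/-- An equivariant image of `α` in `V ⊗ ℂᴺ` is no larger than the part of `α` shared with `V`. A
complement of the kernel meets the kernel of an equivariant projection onto the shared part
trivially, since a minimal invariant subspace of the intersection would embed into `V` through one
of the `N` components. -/
theorem finrank_range_le_finrank_sharedPart {α : Representation ℂ G A}
    {π : Representation ℂ G V} {N : ℕ} (T : A →ₗ[ℂ] Register V N)
    (hT : ∀ g a, T (α g a) = amplify π N g (T a)) :
    Module.finrank ℂ (LinearMap.range T) ≤ Module.finrank ℂ (sharedPart α π) := by
  let P : Subrepresentation α := ⟨sharedPart α π, fun g v hv => sharedPart_invariant α π g v hv⟩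
  let L : Subrepresentation α := ⟨LinearMap.ker T, fun g v hv => by
    rw [LinearMap.mem_ker] at hv ⊢; rw [hT, hv, map_zero]⟩
  obtain ⟨p, hp, hp'⟩ := exists_equivariant_leftInverse (ρ := P.toRepresentation) (α := α)
    P.toSubmodule.subtype (fun _ _ => rfl) P.toSubmodule.subtype_injective
  obtain ⟨q, hq, hq'⟩ := exists_equivariant_leftInverse (ρ := L.toRepresentation) (α := α)
    L.toSubmodule.subtype (fun _ _ => rfl) L.toSubmodule.subtype_injective
  have hbot : LinearMap.ker p ⊓ LinearMap.ker q = ⊥ := by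
    by_contra hne
    obtain ⟨S, hSle, hS0, hSi, hSm⟩ := exists_minimal_invariant α _ (by
      rintro g v ⟨hv, hv'⟩
      rw [SetLike.mem_coe, LinearMap.mem_ker] at hv hv'
      constructor
      · rw [SetLike.mem_coe, LinearMap.mem_ker, hp, hv, map_zero]
      · rw [SetLike.mem_coe, LinearMap.mem_ker, hq, hv', map_zero]) hne
    obtain ⟨v, hv, hv0⟩ := Submodule.exists_mem_ne_zero_of_ne_bot hS0
    have hTv : T v ≠ 0 := by
      intro h
      apply hv0
      have h1 := hq' ⟨v, h⟩
      have h2 : q v = 0 := (hSle hv).2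
      rw [Submodule.subtype_apply, h2] at h1
      exact (congrArg Subtype.val h1).symm
    obtain ⟨i, hi⟩ : ∃ i, component V i (T v) ≠ 0 := by
      by_contra! h
      exact hTv (eq_zero_of_component_eq_zero _ h)
    have hSP : S ≤ sharedPart α π := le_sharedPart S hS0 hSi hSm (component V i ∘ₗ T)
      (fun g a => by simp only [LinearMap.comp_apply, hT, component_amplify]) ⟨v, hv, hi⟩
    have h1 := hp' ⟨v, hSP hv⟩
    have h2 : p v = 0 := (hSle hv).1
    rw [Submodule.subtype_apply, h2] at h1
    exact hv0 (congrArg Subtype.val h1).symm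
  have hinj : Function.Injective (p ∘ₗ (LinearMap.ker q).subtype) := by
    rw [← LinearMap.ker_eq_bot, LinearMap.ker_eq_bot']
    intro v hv
    have : (v : A) ∈ LinearMap.ker p ⊓ LinearMap.ker q := ⟨hv, v.2⟩
    rw [hbot, Submodule.mem_bot] at this
    exact Subtype.ext this
  have h1 : Module.finrank ℂ (LinearMap.ker q) ≤ Module.finrank ℂ (sharedPart α π) :=
    LinearMap.finrank_le_finrank_of_injective hinj
  have h2 := LinearMap.finrank_range_add_finrank_ker q
  have h3 := LinearMap.finrank_range_add_finrank_ker T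
  have h4 : Module.finrank ℂ (LinearMap.range q) ≤ Module.finrank ℂ (LinearMap.ker T) :=
    Submodule.finrank_le _
  omega

omit [FiniteDimensional ℂ A] in
/-- Equivariant maps to `V` separate points of the shared part. -/
theorem eq_zero_of_forall_equivariant {B : Type*} [AddCommGroup B] [Module ℂ B]
    {α : Representation ℂ G A} {β : Representation ℂ G B} {v : A} (hv : v ∈ sharedPart α β)
    (h : ∀ j : A →ₗ[ℂ] B, (∀ g a, j (α g a) = β g (j a)) → j v = 0) : v = 0 := by
  let L : Subrepresentation α :=
    { toSubmodule := sharedPart α β ⊓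
        ⨅ j : {j : A →ₗ[ℂ] B // ∀ g a, j (α g a) = β g (j a)}, LinearMap.ker j.1
      apply_mem_toSubmodule := by
        rintro g v ⟨hv, hv'⟩
        refine ⟨sharedPart_invariant α β g v hv, ?_⟩
        simp only [SetLike.mem_coe, Submodule.mem_iInf, LinearMap.mem_ker] at hv' ⊢
        intro j
        rw [j.2, hv', map_zero] }
  have hLj {w : A} (hw : w ∈ L.toSubmodule) (j : A →ₗ[ℂ] B)
      (hj : ∀ g a, j (α g a) = β g (j a)) : j w = 0 :=
    (Submodule.mem_iInf _).mp hw.2 ⟨j, hj⟩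
  have hvL : v ∈ L.toSubmodule := ⟨hv, (Submodule.mem_iInf _).mpr fun j => h j.1 j.2⟩
  obtain ⟨p, hp, hp'⟩ := exists_equivariant_leftInverse (ρ := L.toRepresentation) (α := α)
    L.toSubmodule.subtype (fun _ _ => rfl) L.toSubmodule.subtype_injective
  by_contra hv0
  have hPp : ¬ sharedPart α β ≤ LinearMap.ker p := by
    intro hle
    have h1 : p v = 0 := hle hv
    have h2 := hp' ⟨v, hvL⟩
    rw [Submodule.subtype_apply, h1] at h2
    exact hv0 (congrArg Subtype.val h2).symm
  obtain ⟨σ, hσ, ⟨τ, ⟨e⟩⟩, hσp⟩ : ∃ σ : Subrepresentation α,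
      σ.toRepresentation.IsIrreducible ∧ (∃ τ : Subrepresentation β,
        Nonempty (σ.toRepresentation.Equiv τ.toRepresentation)) ∧
      ¬ σ.toSubmodule ≤ LinearMap.ker p := by
    by_contra! hcon
    apply hPp
    refine sSup_le ?_
    rintro _ ⟨σ, h1, ⟨τ, h2⟩, rfl⟩
    exact hcon σ h1 ⟨τ, h2⟩
  let m : Representation.IntertwiningMap σ.toRepresentation α :=
    ⟨L.toSubmodule.subtype ∘ₗ p ∘ₗ σ.toSubmodule.subtype, fun g => by
      ext x
      exact congrArg Subtype.val (hp g x)⟩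
  have hm : Function.Injective m := by
    rcases Representation.IsIrreducible.injective_or_eq_zero m with hm | hm
    · exact hm
    · exfalso
      apply hσp
      intro x hx
      have h1 : m ⟨x, hx⟩ = 0 := by rw [hm]; rfl
      exact Subtype.ext h1
  obtain ⟨r, hr, hr'⟩ := exists_equivariant_leftInverse (ρ := σ.toRepresentation) (α := α)
    m.toLinearMap (fun g s => m.isIntertwining _ _ g s) hm
  obtain ⟨x, hx, hxp⟩ := Set.not_subset.mp hσp
  have hj := hLj (p x).2 (τ.toSubmodule.subtype ∘ₗ e.toLinearEquiv.toLinearMap ∘ₗ r) (by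
    intro g a
    simp only [LinearMap.comp_apply, hr]
    exact congrArg Subtype.val (e.toIntertwiningMap.isIntertwining _ _ g (r a)))
  have h1 : r (p x) = ⟨x, hx⟩ := hr' ⟨x, hx⟩
  simp only [LinearMap.comp_apply, h1] at hj
  have h2 : e.toLinearEquiv ⟨x, hx⟩ = 0 := Subtype.ext hj
  rw [LinearEquiv.map_eq_zero_iff] at h2
  have h3 : x = 0 := congrArg Subtype.val h2
  apply hxp
  rw [h3]
  exact Submodule.zero_mem _

/-- Collecting a basis of the space of equivariant maps from `α` to `V` into one map to `V ⊗ ℂᴺ`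
gives an equivariant map which is injective on the shared part. -/
theorem exists_equivariant_injOn_sharedPart [FiniteDimensional ℂ V] (α : Representation ℂ G A)
    (π : Representation ℂ G V) :
    ∃ (N : ℕ) (T : A →ₗ[ℂ] Register V N), (∀ g a, T (α g a) = amplify π N g (T a)) ∧
      Module.finrank ℂ (sharedPart α π) ≤ Module.finrank ℂ (LinearMap.range T) := by
  let J : Submodule ℂ (A →ₗ[ℂ] V) :=
    { carrier := {j | ∀ g a, j (α g a) = π g (j a)}
      add_mem' := fun hj hk g a => by simp [hj g a, hk g a]
      zero_mem' := fun g a => by simp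
      smul_mem' := fun c j hj g a => by simp [hj g a] }
  let b := Module.finBasis ℂ J
  let T : A →ₗ[ℂ] Register V (Module.finrank ℂ J) :=
    ∑ i, (TensorProduct.mk ℂ V _).flip (EuclideanSpace.single i (1 : ℂ)) ∘ₗ (b i).1
  have hTa (a : A) : T a = ∑ i, (b i).1 a ⊗ₜ EuclideanSpace.single i (1 : ℂ) := by
    simp [T]
  have hcomp (i) (a : A) : component V i (T a) = (b i).1 a := by
    rw [hTa, map_sum]
    simp [component_tmul]
  refine ⟨_, T, fun g a => ?_, ?_⟩
  · rw [hTa, hTa, map_sum]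
    refine Finset.sum_congr rfl fun i _ => ?_
    rw [amplify_apply, TensorProduct.map_tmul, (b i).2 g a]
    rfl
  · have hinj : Function.Injective (T.rangeRestrict ∘ₗ (sharedPart α π).subtype) := by
      rw [← LinearMap.ker_eq_bot, LinearMap.ker_eq_bot']
      intro v hv
      have hTv : T v = 0 := congrArg Subtype.val hv
      apply Subtype.ext
      refine eq_zero_of_forall_equivariant v.2 fun j hj => ?_
      have h1 := congrArg J.subtype (b.sum_repr ⟨j, hj⟩)
      rw [map_sum] at h1
      refine (LinearMap.congr_fun h1 (v : A)).symm.trans ?_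
      rw [LinearMap.sum_apply]
      refine Finset.sum_eq_zero fun i _ => ?_
      have h2 : (b i).1 (v : A) = 0 := by rw [← hcomp, hTv, map_zero]
      rw [map_smul, LinearMap.smul_apply, Submodule.subtype_apply, h2, smul_zero]
    exact LinearMap.finrank_le_finrank_of_injective hinj

end Shared

/-! ### Induced representations -/

section Induced

open Representation

variable {G Y : Type*} [Group G] {H : Subgroup G} [AddCommGroup Y] [Module ℂ Y]
  (ρ : Representation ℂ H Y)

/-- The defining relation of the induced representation. The vector `IndV.mk g y` stands for
`g⁻¹ ⊗ y` in `ℂ[G] ⊗_{ℂ[H]} Y`. -/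
theorem indV_mk_mul (h : H) (g : G) (y : Y) :
    IndV.mk H.subtype ρ ((h : G) * g) (ρ h y) = IndV.mk H.subtype ρ g y := by
  have := Coinvariants.mk_self_apply
    (Representation.tprod ((leftRegular ℂ G).comp H.subtype) ρ) h
    (MonoidAlgebra.single g 1 ⊗ₜ y)
  simpa using this

/-- Linear maps out of the induced representation are families of linear maps indexed by `G` which
respect the defining relation. -/
theorem exists_indV_lift {B : Type*} [AddCommGroup B] [Module ℂ B] (F : G → Y →ₗ[ℂ] B)
    (hF : ∀ (h : H) (g : G) (y : Y), F (h * g) (ρ h y) = F g y) :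
    ∃ T : IndV H.subtype ρ →ₗ[ℂ] B, ∀ g y, T (IndV.mk H.subtype ρ g y) = F g y := by
  refine ⟨Coinvariants.lift _ (TensorProduct.lift <| (Finsupp.lift _ _ _ F) ∘ₗ
      (MonoidAlgebra.coeffLinearEquiv ℂ).toLinearMap) fun h => ?_, fun g y => ?_⟩
  · ext g y
    simpa using hF h g y
  · simp

theorem indV_hom_congr {B : Type*} [AddCommGroup B] [Module ℂ B]
    {S T : IndV H.subtype ρ →ₗ[ℂ] B}
    (h : ∀ g y, S (IndV.mk H.subtype ρ g y) = T (IndV.mk H.subtype ρ g y)) : S = T :=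
  IndV.hom_ext _ _ fun g => LinearMap.ext fun y => h g y

theorem ind_apply_mk (g g' : G) (y : Y) :
    Representation.ind H.subtype ρ g (IndV.mk H.subtype ρ g' y) =
      IndV.mk H.subtype ρ (g' * g⁻¹) y :=
  ind_mk _ _ _ _ _

variable {ρ}

/-- The image of an equivariant map out of an induced representation is spanned by the translates of
the image of the inducing representation. -/
theorem range_eq_repSpan {W : Type*} [NormedAddCommGroup W] [InnerProductSpace ℂ W]
    {τ : Representation ℂ G W} (T : IndV H.subtype ρ →ₗ[ℂ] W)
    (hT : ∀ g z, T (Representation.ind H.subtype ρ g z) = τ g (T z)) :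
    LinearMap.range T = repSpan τ (LinearMap.range (T ∘ₗ IndV.mk H.subtype ρ 1)) := by
  have hmk (g : G) (y : Y) :
      T (IndV.mk H.subtype ρ g y) = τ g⁻¹ (T (IndV.mk H.subtype ρ 1 y)) := by
    rw [← hT, ind_apply_mk, one_mul, inv_inv]
  apply le_antisymm
  · rw [← Submodule.ker_mkQ (repSpan τ _), LinearMap.range_le_ker_iff]
    refine indV_hom_congr ρ fun g y => ?_
    rw [LinearMap.comp_apply, LinearMap.zero_apply, Submodule.mkQ_apply,
      Submodule.Quotient.mk_eq_zero, hmk]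
    exact le_iSup (fun g => Submodule.map (τ g) _) g⁻¹ ⟨_, ⟨y, rfl⟩, rfl⟩
  · refine iSup_le fun g => ?_
    rintro _ ⟨_, ⟨y, rfl⟩, rfl⟩
    exact ⟨_, hT g _⟩

theorem comp_mk_one_equivariant {W : Type*} [NormedAddCommGroup W] [InnerProductSpace ℂ W]
    {τ : Representation ℂ G W} (T : IndV H.subtype ρ →ₗ[ℂ] W)
    (hT : ∀ g z, T (Representation.ind H.subtype ρ g z) = τ g (T z)) (h : H) (y : Y) :
    (T ∘ₗ IndV.mk H.subtype ρ 1) (ρ h y) = τ h ((T ∘ₗ IndV.mk H.subtype ρ 1) y) := by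
  have h1 := indV_mk_mul ρ h (h : G)⁻¹ y
  rw [mul_inv_cancel] at h1
  change T (IndV.mk H.subtype ρ 1 (ρ h y)) = τ h (T (IndV.mk H.subtype ρ 1 y))
  rw [h1, ← hT, ind_apply_mk, one_mul]

/-- Frobenius reciprocity: an `H`-equivariant map extends to the induced representation. -/
theorem exists_ind_lift {W : Type*} [NormedAddCommGroup W] [InnerProductSpace ℂ W]
    {τ : Representation ℂ G W} (t : Y →ₗ[ℂ] W) (ht : ∀ (h : H) y, t (ρ h y) = τ h (t y)) :
    ∃ T : IndV H.subtype ρ →ₗ[ℂ] W,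
      (∀ g z, T (Representation.ind H.subtype ρ g z) = τ g (T z)) ∧
      T ∘ₗ IndV.mk H.subtype ρ 1 = t := by
  obtain ⟨T, hT⟩ := exists_indV_lift ρ (fun g => τ g⁻¹ ∘ₗ t) (fun h g y => by
    simp only [LinearMap.comp_apply, ht]
    rw [← Module.End.mul_apply, ← map_mul, mul_inv_rev, inv_mul_cancel_right])
  refine ⟨T, fun g => LinearMap.congr_fun (f := T ∘ₗ Representation.ind H.subtype ρ g)
    (g := τ g ∘ₗ T) (indV_hom_congr ρ fun g' y => ?_), ?_⟩
  · change T (Representation.ind H.subtype ρ g (IndV.mk H.subtype ρ g' y)) =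
      τ g (T (IndV.mk H.subtype ρ g' y))
    rw [ind_apply_mk, hT, hT, mul_inv_rev, inv_inv,
      map_mul]
    rfl
  · ext y
    change T (IndV.mk H.subtype ρ 1 y) = t y
    rw [hT, inv_one, map_one]
    rfl

/-- The induced representation is isomorphic to `X → Y` as a vector space, through the choice of an
element `s x` carrying `x₀` to `x` for every `x`. -/
theorem finrank_indV {G X Y : Type*} [Group G] [Fintype X] [MulAction G X]
    [MulAction.IsPretransitive G X] (x₀ : X) [AddCommGroup Y] [Module ℂ Y]
    [FiniteDimensional ℂ Y] (ρ : Representation ℂ (MulAction.stabilizer G x₀) Y) :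
    Module.finrank ℂ (IndV (MulAction.stabilizer G x₀).subtype ρ) =
      Fintype.card X * Module.finrank ℂ Y := by
  classical
  choose s hs using MulAction.exists_smul_eq G x₀
  have hmem (g : G) : (s (g⁻¹ • x₀))⁻¹ * g⁻¹ ∈ MulAction.stabilizer G x₀ := by
    rw [MulAction.mem_stabilizer_iff, mul_smul, inv_smul_eq_iff, hs]
  obtain ⟨Φ, hΦ⟩ := exists_indV_lift ρ
    (fun g => LinearMap.single ℂ (fun _ : X => Y) (g⁻¹ • x₀) ∘ₗ ρ ⟨_, hmem g⟩) (fun h g y => by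
      have h1 : ((h : G) * g)⁻¹ • x₀ = g⁻¹ • x₀ := by
        rw [mul_inv_rev, mul_smul]
        congr 1
        exact (h⁻¹).2
      have h2 : (⟨_, hmem (h * g)⟩ : MulAction.stabilizer G x₀) * h = ⟨_, hmem g⟩ := by
        apply Subtype.ext
        simp only [Subgroup.coe_mul]
        rw [h1]
        group
      simp only [LinearMap.comp_apply]
      rw [← Module.End.mul_apply, ← map_mul, h2]
      simp only [h1])
  let Ψ : (X → Y) →ₗ[ℂ] IndV (MulAction.stabilizer G x₀).subtype ρ :=
    ∑ x, IndV.mk _ ρ (s x)⁻¹ ∘ₗ LinearMap.proj x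
  have hΨ (φ : X → Y) : Ψ φ = ∑ x, IndV.mk _ ρ (s x)⁻¹ (φ x) := by
    simp [Ψ]
  have h1 : Ψ ∘ₗ Φ = LinearMap.id := by
    refine indV_hom_congr ρ fun g y => ?_
    rw [LinearMap.comp_apply, hΦ, hΨ, LinearMap.id_apply, Finset.sum_eq_single (g⁻¹ • x₀)]
    · have h2 := indV_mk_mul ρ ⟨_, hmem g⟩ g y
      simp only [inv_mul_cancel_right] at h2
      rw [← h2]
      simp
    · intro x _ hx
      simp [hx]
    · intro h
      exact absurd (Finset.mem_univ _) h
  have h2 : Φ ∘ₗ Ψ = LinearMap.id := by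
    refine LinearMap.ext fun φ => ?_
    rw [LinearMap.comp_apply, hΨ, map_sum, LinearMap.id_apply]
    refine (Finset.sum_congr rfl fun x _ => ?_).trans (LinearMap.sum_single_apply (fun _ => Y) φ)
    rw [hΦ]
    have h3 : (s x)⁻¹⁻¹ • x₀ = x := by rw [inv_inv, hs]
    have h4 : (⟨_, hmem (s x)⁻¹⟩ : MulAction.stabilizer G x₀) = 1 := by
      apply Subtype.ext
      simp [hs]
    rw [h4, map_one, LinearMap.comp_apply, h3]
    rfl
  rw [(LinearEquiv.ofLinearMap Φ Ψ h2 h1).finrank_eq, Module.finrank_pi_fintype]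
  simp

end Induced

/-! ### Optimal single-query algorithms -/

section Optimum

open Representation

/-- An irreducible representation is spanned by the orbit of any nonzero vector. -/
theorem finrank_le_card_of_isIrreducible {H Y : Type*} [Group H] [Finite H] [AddCommGroup Y]
    [Module ℂ Y] {ρ : Representation ℂ H Y} (hρ : ρ.IsIrreducible) :
    Module.finrank ℂ Y ≤ Nat.card H := by
  have := Fintype.ofFinite H
  have hY : ∃ y : Y, y ≠ 0 := by
    by_contra! h
    obtain ⟨a, b, hab⟩ := hρ.exists_pair_ne
    refine hab (Subrepresentation.toSubmodule_injective ?_)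
    ext y
    simp [h y]
  obtain ⟨y, hy⟩ := hY
  let σ : Subrepresentation ρ :=
    { toSubmodule := Submodule.span ℂ (Set.range fun h => ρ h y)
      apply_mem_toSubmodule := fun g v hv => by
        have hle : Submodule.span ℂ (Set.range fun h => ρ h y) ≤
            (Submodule.span ℂ (Set.range fun h => ρ h y)).comap (ρ g) := by
          rw [Submodule.span_le]
          rintro _ ⟨h, rfl⟩
          refine Submodule.subset_span ⟨g * h, ?_⟩
          simp only [map_mul]
          rfl
        exact hle hv }
  have hyσ : y ∈ σ.toSubmodule := Submodule.subset_span ⟨1, by simp⟩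
  have hσ : σ = ⊤ := by
    refine (hρ.eq_bot_or_eq_top σ).resolve_left fun h => hy ?_
    rw [h] at hyσ
    exact hyσ
  have htop : Submodule.span ℂ (Set.range fun h => ρ h y) = ⊤ :=
    congrArg Subrepresentation.toSubmodule hσ
  rw [← finrank_top ℂ Y, ← htop, Nat.card_eq_fintype_card]
  exact finrank_range_le_card _

variable {G V X : Type*} [Group G] [Fintype G]
  [NormedAddCommGroup V] [InnerProductSpace ℂ V] [FiniteDimensional ℂ V]
  [Fintype X]

/-- The measurement operators `U⁻¹ E_x U`, which absorb the unitary of the algorithm. -/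
noncomputable def pullback (𝒜 : SingleQueryAlgorithm V X) (x : X) :
    Register V 𝒜.N →ₗ[ℂ] Register V 𝒜.N :=
  𝒜.U.symm.toLinearEquiv.toLinearMap ∘ₗ 𝒜.E x ∘ₗ 𝒜.U.toLinearEquiv.toLinearMap

omit [FiniteDimensional ℂ V] in
theorem inner_pullback (𝒜 : SingleQueryAlgorithm V X) (x : X) (v w : Register V 𝒜.N) :
    inner ℂ v (pullback 𝒜 x w) = inner ℂ (𝒜.U v) (𝒜.E x (𝒜.U w)) := by
  rw [← 𝒜.U.inner_map_map v]
  congr 1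
  exact 𝒜.U.apply_symm_apply _

omit [FiniteDimensional ℂ V] in
theorem successProb_eq_averageSuccess (𝒜 : SingleQueryAlgorithm V X) (π : Representation ℂ G V)
    (f : G → X) :
    𝒜.successProb π f = averageSuccess (amplify π 𝒜.N) (pullback 𝒜) f 𝒜.state := by
  rw [SingleQueryAlgorithm.successProb, averageSuccess]
  congr 1
  refine Finset.sum_congr rfl fun a _ => ?_
  rw [inner_pullback]
  rfl

omit [FiniteDimensional ℂ V] in
theorem pullback_isPositive (𝒜 : SingleQueryAlgorithm V X) (x : X) :
    (pullback 𝒜 x).IsPositive :=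
  (LinearMap.isPositive_linearIsometryEquiv_conj_iff 𝒜.U.symm).mpr (𝒜.isPositive_E x)

omit [FiniteDimensional ℂ V] in
theorem sum_pullback (𝒜 : SingleQueryAlgorithm V X) : ∑ x, pullback 𝒜 x = 1 := by
  refine LinearMap.ext fun w => ?_
  simp only [pullback]
  rw [LinearMap.sum_apply]
  simp only [LinearMap.comp_apply]
  rw [← map_sum, ← LinearMap.sum_apply, 𝒜.sum_E]
  exact 𝒜.U.symm_apply_apply w

/-- The algorithm which measures immediately after the query. -/
noncomputable def algorithmOfPOVM {N : ℕ} (E : X → (Register V N →ₗ[ℂ] Register V N))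
    (hE : ∀ x, (E x).IsPositive) (hE1 : ∑ x, E x = 1) (ψ : Register V N) (hψ : ‖ψ‖ = 1) :
    SingleQueryAlgorithm V X where
  N := N
  state := ψ
  norm_state := hψ
  U := LinearIsometryEquiv.refl ℂ _
  E := E
  isPositive_E := hE
  sum_E := hE1

omit [FiniteDimensional ℂ V] in
theorem successProb_algorithmOfPOVM {N : ℕ} (E : X → (Register V N →ₗ[ℂ] Register V N))
    (hE : ∀ x, (E x).IsPositive) (hE1 : ∑ x, E x = 1) (ψ : Register V N) (hψ : ‖ψ‖ = 1)
    (π : Representation ℂ G V) (f : G → X) :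
    (algorithmOfPOVM E hE hE1 ψ hψ).successProb π f = averageSuccess (amplify π N) E f ψ := rfl

omit [FiniteDimensional ℂ V] in
theorem successProb_nonneg (𝒜 : SingleQueryAlgorithm V X) (π : Representation ℂ G V)
    (f : G → X) : 0 ≤ 𝒜.successProb π f :=
  mul_nonneg (by positivity)
    (Finset.sum_nonneg fun _ _ => (𝒜.isPositive_E _).re_inner_nonneg_right _)

variable [MulAction G X] [MulAction.IsPretransitive G X]

theorem successProb_le_sharedFraction {π : Representation ℂ G V} (hπ : IsUnitaryRep π)
    {f : G → X} (hf : ∀ g h : G, f (g * h) = g • f h) (x₀ : X) (𝒜 : SingleQueryAlgorithm V X) :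
    ∃ (n : ℕ) (ρ : Representation ℂ (MulAction.stabilizer G x₀) (Fin n → ℂ)),
      ρ.IsIrreducible ∧ 𝒜.successProb π f ≤ sharedFraction ρ π := by
  obtain ⟨Y, hY0, hYi, hYm, hle⟩ := averageSuccess_upper (amplify_isUnitaryRep hπ 𝒜.N)
    (pullback 𝒜) (pullback_isPositive 𝒜) (sum_pullback 𝒜) f hf x₀ 𝒜.state 𝒜.norm_state
  rw [← successProb_eq_averageSuccess] at hle
  set τ := amplify π 𝒜.N
  let σ : Subrepresentation (τ.comp (MulAction.stabilizer G x₀).subtype) :=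
    ⟨Y, fun h v hv => hYi h v hv⟩
  let e : (Fin (Module.finrank ℂ Y) → ℂ) ≃ₗ[ℂ] Y := (Module.finBasis ℂ Y).equivFun.symm
  let ρ : Representation ℂ (MulAction.stabilizer G x₀) (Fin (Module.finrank ℂ Y) → ℂ) :=
    (e.symm.conjAlgEquiv ℂ : Module.End ℂ Y →* _).comp σ.toRepresentation
  let t : (Fin (Module.finrank ℂ Y) → ℂ) →ₗ[ℂ] Register V 𝒜.N := Y.subtype ∘ₗ e.toLinearMap
  have ht (h : MulAction.stabilizer G x₀) (y) : t (ρ h y) = τ h (t y) :=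
    congrArg Subtype.val (e.apply_symm_apply (σ.toRepresentation h (e y)))
  have hrange : LinearMap.range t = Y := by
    rw [LinearMap.range_comp, LinearEquiv.range, Submodule.map_top, Submodule.range_subtype]
  have hρ : ρ.IsIrreducible := by
    refine isIrreducible_of_minimal_range (α := τ.comp (MulAction.stabilizer G x₀).subtype) t ht
      (Y.subtype_injective.comp e.injective) ?_ ?_
    · rwa [hrange]
    · rw [hrange]; exact hYm
  refine ⟨_, ρ, hρ, ?_⟩
  obtain ⟨T, hT, hT1⟩ := exists_ind_lift (ρ := ρ) (τ := τ) t ht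
  have h1 := range_eq_repSpan T hT
  rw [hT1, hrange] at h1
  have h2 : (Module.finrank ℂ (repSpan τ Y) : ℝ) ≤
      Module.finrank ℂ (sharedPart
        (Representation.ind (MulAction.stabilizer G x₀).subtype ρ) π) := by
    rw [← h1]
    exact_mod_cast finrank_range_le_finrank_sharedPart T hT
  have hn : 0 < Module.finrank ℂ Y :=
    Module.finrank_pos_iff.mpr (Submodule.nontrivial_iff_ne_bot.mpr hY0)
  have hX : 0 < Fintype.card X := Fintype.card_pos_iff.mpr ⟨x₀⟩
  rw [sharedFraction, finrank_indV, Module.finrank_fin_fun, le_div_iff₀ (by positivity)]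
  push_cast
  exact hle.trans h2

/-- The fraction of any representation of `H` is reached by the square-root measurement for its
image in a suitable `V ⊗ ℂᴺ`. -/
theorem exists_sharedFraction_le_successProb [Nontrivial V] {π : Representation ℂ G V}
    (hπ : IsUnitaryRep π)
    {f : G → X} (hf : ∀ g h : G, f (g * h) = g • f h) (x₀ : X) (n : ℕ)
    (ρ : Representation ℂ (MulAction.stabilizer G x₀) (Fin n → ℂ)) :
    ∃ 𝒜 : SingleQueryAlgorithm V X, sharedFraction ρ π ≤ 𝒜.successProb π f := by
  obtain ⟨N, T, hT, hTr⟩ := exists_equivariant_injOn_sharedPart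
    (Representation.ind (MulAction.stabilizer G x₀).subtype ρ) π
  have hrange := range_eq_repSpan T hT
  set t := T ∘ₗ IndV.mk (MulAction.stabilizer G x₀).subtype ρ 1 with ht
  by_cases hB : LinearMap.range t = ⊥
  -- Here nothing is shared, so the fraction is zero and any algorithm will do.
  · obtain ⟨v, hv⟩ := exists_ne (0 : V)
    have hne : (⊤ : Submodule ℂ (Register V 1)) ≠ ⊥ := by
      intro h
      have h1 : v ⊗ₜ[ℂ] EuclideanSpace.single (0 : Fin 1) (1 : ℂ) ∈
          (⊤ : Submodule ℂ (Register V 1)) := trivial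
      rw [h, Submodule.mem_bot] at h1
      have h2 := congrArg (component V (0 : Fin 1)) h1
      rw [component_tmul, map_zero] at h2
      apply hv
      simpa using h2
    obtain ⟨E, hE, hE1, ψ, hψ, -⟩ := averageSuccess_lower (amplify_isUnitaryRep hπ 1) f hf x₀ ⊤ hne
      (fun _ _ _ => trivial)
    refine ⟨algorithmOfPOVM E hE hE1 ψ hψ, le_trans (le_of_eq ?_) (successProb_nonneg _ _ _)⟩
    have h0 : Module.finrank ℂ (sharedPart (Representation.ind
        (MulAction.stabilizer G x₀).subtype ρ) π) = 0 := by
      have hbot : repSpan (amplify π N) (⊥ : Submodule ℂ (Register V N)) = ⊥ := by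
        rw [repSpan, iSup_eq_bot]
        exact fun g => Submodule.map_bot _
      rw [hrange, hB, hbot, finrank_bot] at hTr
      exact Nat.le_zero.mp hTr
    rw [sharedFraction, h0, Nat.cast_zero, zero_div]
  · obtain ⟨E, hE, hE1, ψ, hψ, hle⟩ := averageSuccess_lower (amplify_isUnitaryRep hπ N) f hf x₀
      (LinearMap.range t) hB (by
        rintro h _ ⟨y, rfl⟩
        exact ⟨ρ h y, comp_mk_one_equivariant T hT h y⟩)
    refine ⟨algorithmOfPOVM E hE hE1 ψ hψ, ?_⟩
    have h0 := successProb_nonneg (algorithmOfPOVM E hE hE1 ψ hψ) π f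
    rw [← successProb_algorithmOfPOVM E hE hE1 ψ hψ, ← hrange] at hle
    have hBn : Module.finrank ℂ (LinearMap.range t) ≤ n := by
      simpa using LinearMap.finrank_range_le t
    rw [sharedFraction, finrank_indV, Module.finrank_fin_fun]
    refine div_le_of_le_mul₀ (by positivity) h0 ?_
    push_cast
    calc (Module.finrank ℂ (sharedPart _ π) : ℝ) ≤ Module.finrank ℂ (LinearMap.range T) := by
          exact_mod_cast hTr
      _ ≤ _ := hle
      _ ≤ _ := by gcongr

omit [FiniteDimensional ℂ V] in
/-- The dimensions of irreducible representations of `H` are bounded, so the fractions take finitely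
many values. -/
theorem finite_sharedFraction (π : Representation ℂ G V) (x₀ : X) :
    {q : ℝ | ∃ (n : ℕ) (ρ : Representation ℂ (MulAction.stabilizer G x₀) (Fin n → ℂ)),
        ρ.IsIrreducible ∧ q = sharedFraction ρ π}.Finite := by
  set K := Fintype.card X * Nat.card (MulAction.stabilizer G x₀)
  refine ((Set.finite_Iic K).prod (Set.finite_Iic K)).image
    (fun p : ℕ × ℕ => (p.1 : ℝ) / p.2) |>.subset ?_
  rintro _ ⟨n, ρ, hρ, rfl⟩
  have h1 := finrank_le_card_of_isIrreducible hρ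
  have h2 : Module.finrank ℂ (IndV (MulAction.stabilizer G x₀).subtype ρ) ≤ K := by
    rw [finrank_indV]
    exact Nat.mul_le_mul_left _ h1
  exact ⟨(_, _), ⟨(Submodule.finrank_le _).trans h2, h2⟩, rfl⟩

end Optimum
end CosetIdentification

open CosetIdentification in
/-- For an instance `(G, V, f)` of coset identification, with `H` the stabilizer of a point of the
transitive `G`-set `X`, the largest success probability of a single-query algorithm exists and
equals the maximum of `dim (Y↑)_V / dim Y↑` over the irreducible representations `Y` of `H` (each
of which is isomorphic to one on some `ℂⁿ`). -/
theorem theorem5p1 {G V X : Type*} [Group G] [Fintype G]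
    [NormedAddCommGroup V] [InnerProductSpace ℂ V] [FiniteDimensional ℂ V] [Nontrivial V]
    (π : Representation ℂ G V)
    (hπ : ∀ (g : G) (v w : V), inner ℂ (π g v) (π g w) = inner ℂ v w)
    [Fintype X] [MulAction G X] [MulAction.IsPretransitive G X]
    (f : G → X) (hf : ∀ g h : G, f (g * h) = g • f h) (x₀ : X) :
    ∃ P : ℝ,
      IsGreatest {p : ℝ | ∃ 𝒜 : SingleQueryAlgorithm V X, p = 𝒜.successProb π f} P ∧
      IsGreatest {q : ℝ | ∃ (n : ℕ)
        (ρ : Representation ℂ (MulAction.stabilizer G x₀) (Fin n → ℂ)),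
        ρ.IsIrreducible ∧ q = sharedFraction ρ π} P := by
  set Q : Set ℝ := {q : ℝ | ∃ (n : ℕ)
    (ρ : Representation ℂ (MulAction.stabilizer G x₀) (Fin n → ℂ)),
    ρ.IsIrreducible ∧ q = sharedFraction ρ π} with hQ
  have hupper (𝒜 : SingleQueryAlgorithm V X) : ∃ q ∈ Q, 𝒜.successProb π f ≤ q := by
    obtain ⟨n, ρ, hρ, h⟩ := successProb_le_sharedFraction hπ hf x₀ 𝒜
    exact ⟨_, ⟨n, ρ, hρ, rfl⟩, h⟩
  have hne : Q.Nonempty := by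
    -- Any representation provides an algorithm, and the upper bound then an irreducible one.
    obtain ⟨𝒜, -⟩ := exists_sharedFraction_le_successProb hπ hf x₀ 0 1
    obtain ⟨q, hq, -⟩ := hupper 𝒜
    exact ⟨q, hq⟩
  obtain ⟨P, hP⟩ : ∃ P, IsGreatest Q P := by
    obtain ⟨P, hP, hmax⟩ := Set.exists_max_image Q id (finite_sharedFraction π x₀) hne
    exact ⟨P, hP, fun q hq => hmax q hq⟩
  have hbound (𝒜 : SingleQueryAlgorithm V X) : 𝒜.successProb π f ≤ P := by
    obtain ⟨q, hq, h⟩ := hupper 𝒜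
    exact h.trans (hP.2 hq)
  refine ⟨P, ⟨?_, ?_⟩, hP⟩
  · obtain ⟨n, ρ, hρ, hPρ⟩ := hP.1
    obtain ⟨𝒜, h𝒜⟩ := exists_sharedFraction_le_successProb hπ hf x₀ n ρ
    exact ⟨𝒜, le_antisymm (hPρ.trans_le h𝒜) (hbound 𝒜)⟩
  · rintro _ ⟨𝒜, rfl⟩
    exact hbound 𝒜
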